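/- Let $S\ge 1$ and let $p_0$ be a probability mass function on $\mathbb N=\{0,1,2,\dots\}$ with support $\{0,\dots,S\}$ that is convex, i.e. $\Delta p_0(k):=p_0(k+1)-2p_0(k)+p_0(k-1)\ge 0$ for all $k\ge 1$. An integer $k\ge 1$ is a knot of $p_0$ if $\Delta p_0(k)>0$ (so $S+1$ is the largest knot), and a double knot of $p_0$ if both $k$ and $k+1$ are knots of $p_0$. Let $s_1<\dots<s_m$ ($m\ge 0$) be the knots of $p_0$ strictly between $0$ and $S+1$, and put $s_0=0$, $s_{m+1}=S+1$. Let $X_1,X_2,\dots$ be i.i.d. with probability mass function $p_0$, let $p_n(j)=\frac1n\sum_{i=1}^n \mathbf 1_{\{X_i=j\}}$ be the empirical probability mass function, and let $\widehat p_n$ be the convex least-squares estimator, i.e. the unique minimizer of $\frac12\sum_{j\in\mathbb N}(p_n(j)-p(j))^2$ over all sequences $p=(p(j))_{j\in\mathbb N}$ with $\sum_j p(j)^2<\infty$ and $\Delta p(k)\ge0$ for all $k\ge1$. Let $k_1<\dots<k_I$ be points of $\mathbb N$. Let $s\le k_1$ be such that either $s-1$ is a double knot of $p_0$ or $s=0$;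 let $s'\ge k_I$ be such that either $s'$ is a double knot of $p_0$ or $s'\ge S+1$; and let $z,z'\in\mathbb N$ with $z\le s$ and $z'\ge s'$ be arbitrary. Then: (i) With probability one there exists $n_0$ such that for all $n\ge n_0$, $(\widehat p_n(k_1),\dots,\widehat p_n(k_I))$ is the restriction to $\{k_1,\dots,k_I\}$ of the unique minimizer of $\frac12\sum_{k=z}^{z'}(p_n(k)-p(k))^2$ over the set of convex sequences $(p(z),p(z+1),\dots,p(z'))$. (ii) As $n\to\infty$, $\sqrt n\,\big(\widehat p_n(k_1)-p_0(k_1),\dots,\widehat p_n(k_I)-p_0(k_I)\big)$ converges in distribution to the restriction to $\{k_1,\dots,k_I\}$ of the unique minimizer of $\frac12\sum_{k=z}^{z'}(g(k)-\mathbb W(k))^2$ over the set of sequences $g=(g(z),\dots,g(z'))$ that are convex on $\{s_j,\dots,s_{j+1}\}$ for all $j\in\{0,\dots,m\}$ with $s_j\ge z$ and $s_{j+1}\le z'$. Here $\mathbb W(k)=\mathbb U(F_{p_0}(k))-\mathbb U(F_{p_0}(k-1))$ for $k\in\mathbb N$, where $\mathbb U$ is a standard Brownian bridge on $[0,1]$,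 $F_{p_0}(k)=\sum_{j=0}^k p_0(j)$ and $F_{p_0}(-1)=0$. -/

import Mathlib

open MeasureTheory ProbabilityTheory Filter

namespace ConvexPmf

/-! ### Least-squares minimizers -/

/-- The criterion `(1/2) ∑ (y j - p j)²`. On a finite index type the sum is the finite sum. -/
noncomputable def lsCriterion {ι : Type*} (y p : ι → ℝ) : ℝ :=
  (1 / 2) * ∑' j, (y j - p j) ^ 2

/-- `p` minimizes the least-squares criterion with target `y` over `K`. -/
def IsLeastSquares {ι : Type*} (K : Set (ι → ℝ)) (y p : ι → ℝ) : Prop :=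
  p ∈ K ∧ ∀ q ∈ K, lsCriterion y p ≤ lsCriterion y q

open Classical in
/-- The minimizer of the least-squares criterion with target `y` over `K`; existence and
uniqueness, in all the cases used here, are proved below. -/
noncomputable def leastSquares {ι : Type*} (K : Set (ι → ℝ)) (y : ι → ℝ) : ι → ℝ :=
  if h : ∃ p, IsLeastSquares K y p then h.choose else 0

theorem existsUnique_isLeastSquares {ι : Type*} (K : Set (ι → ℝ)) (hc : IsClosed K)
    (hconv : Convex ℝ K) (h0 : (0 : ι → ℝ) ∈ K) (y : ι → ℝ) (hy : Summable fun j => y j ^ 2) :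
    ∃! p, IsLeastSquares (K ∩ {p | Summable fun j => p j ^ 2}) y p := by
  have hmem : ∀ f : ι → ℝ, (Summable fun j => f j ^ 2) ↔ Memℓp f 2 := by
    intro f
    rw [memℓp_gen_iff (by norm_num)]
    simp
  have hnorm : ∀ f : lp (fun _ : ι => ℝ) 2, ∑' j, (f j) ^ 2 = ‖f‖ ^ 2 := by
    intro f
    have h := lp.norm_rpow_eq_tsum (p := 2) (by norm_num) f
    simp at h
    exact h.symm
  let u : lp (fun _ : ι => ℝ) 2 := ⟨y, (hmem y).1 hy⟩
  let L : Set (lp (fun _ : ι => ℝ) 2) := {f | (f : ι → ℝ) ∈ K}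
  have hLc : IsClosed L := hc.preimage (lp.uniformContinuous_coe (p := 2)).continuous
  have hLconv : Convex ℝ L := by
    intro f hf g hg a b ha hb hab
    exact hconv hf hg ha hb hab
  have hLne : L.Nonempty := ⟨0, h0⟩
  have hcrit : ∀ f : lp (fun _ : ι => ℝ) 2, lsCriterion y f = (1 / 2) * ‖u - f‖ ^ 2 := by
    intro f
    rw [← hnorm (u - f)]
    rfl
  obtain ⟨v, hvL, hv⟩ := exists_norm_eq_iInf_of_complete_convex hLne hLc.isComplete hLconv u
  have hin := (norm_eq_iInf_iff_real_inner_le_zero hLconv hvL).1 hv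
  have key : ∀ w ∈ L, ‖u - v‖ ^ 2 + ‖w - v‖ ^ 2 ≤ ‖u - w‖ ^ 2 := by
    intro w hw
    have h1 := hin w hw
    have h2 := norm_sub_sq_real (u - v) (w - v)
    have h3 : u - v - (w - v) = u - w := by abel
    rw [h3] at h2
    linarith
  refine ⟨v, ⟨⟨hvL, (hmem _).2 v.2⟩, ?_⟩, ?_⟩
  · rintro q ⟨hqK, hq⟩
    have h1 := hcrit v
    have h2 := hcrit ⟨q, (hmem q).1 hq⟩
    have h3 := key ⟨q, (hmem q).1 hq⟩ hqK
    have h4 := sq_nonneg ‖(⟨q, (hmem q).1 hq⟩ : lp (fun _ : ι => ℝ) 2) - v‖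
    change lsCriterion y q = _ at h2
    rw [h1, h2]
    linarith
  · rintro q ⟨⟨hqK, hq⟩, hmin⟩
    have h5 := hmin v ⟨hvL, (hmem _).2 v.2⟩
    have h1 := hcrit v
    have h2 := hcrit ⟨q, (hmem q).1 hq⟩
    have h3 := key ⟨q, (hmem q).1 hq⟩ hqK
    change lsCriterion y q = _ at h2
    rw [h1, h2] at h5
    have h6 : ‖(⟨q, (hmem q).1 hq⟩ : lp (fun _ : ι => ℝ) 2) - v‖ ^ 2 = 0 :=
      le_antisymm (by linarith) (sq_nonneg _)
    have h7 := sub_eq_zero.1 (norm_eq_zero.1 (pow_eq_zero_iff (two_ne_zero) |>.1 h6))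
    exact congrArg (fun f : lp (fun _ : ι => ℝ) 2 => (f : ι → ℝ)) h7

theorem leastSquares_spec {ι : Type*} {K : Set (ι → ℝ)} {y : ι → ℝ}
    (h : ∃ p, IsLeastSquares K y p) : IsLeastSquares K y (leastSquares K y) := by
  unfold leastSquares
  rw [dif_pos h]
  exact h.choose_spec

/-! ### Convex sequences, knots, and the convex least-squares estimator -/

/-- The discrete Laplacian `p (k+1) - 2 p k + p (k-1)`; only used at `k ≥ 1`. -/
def laplacian (p : ℕ → ℝ) (k : ℕ) : ℝ := p (k + 1) - 2 * p k + p (k - 1)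

/-- `k` is a knot of `p`. -/
def IsKnot (p : ℕ → ℝ) (k : ℕ) : Prop := 1 ≤ k ∧ 0 < laplacian p k

/-- `k` is a double knot of `p`: both `k` and `k + 1` are knots. -/
def IsDoubleKnot (p : ℕ → ℝ) (k : ℕ) : Prop := IsKnot p k ∧ IsKnot p (k + 1)

/-- The square-summable convex sequences on `ℕ`. -/
def convexSeqs : Set (ℕ → ℝ) :=
  {p | ∀ k, 1 ≤ k → 0 ≤ laplacian p k} ∩ {p | Summable fun j => p j ^ 2}

/-- The convex least-squares estimator built on the sequence `y`. -/
noncomputable def convexLSE (y : ℕ → ℝ) : ℕ → ℝ := leastSquares convexSeqs y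

theorem existsUnique_convexLSE (y : ℕ → ℝ) (hy : Summable fun j => y j ^ 2) :
    ∃! p, IsLeastSquares convexSeqs y p := by
  refine existsUnique_isLeastSquares _ ?_ ?_ ?_ y hy
  · simp only [laplacian, Set.ofPred_forall]
    refine isClosed_iInter fun k => isClosed_iInter fun _ => ?_
    exact isClosed_le continuous_const (by fun_prop)
  · intro p hp q hq a b ha hb _ k hk
    have h1 := mul_nonneg ha (hp k hk)
    have h2 := mul_nonneg hb (hq k hk)
    simp only [laplacian, Pi.add_apply, Pi.smul_apply, smul_eq_mul] at *
    linarith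
  · intro k _
    simp [laplacian]

/-- The empirical probability mass function of the sample `X 0, …, X (n - 1)`. -/
noncomputable def empiricalPmf {Ω : Type*} (X : ℕ → Ω → ℕ) (n : ℕ) (ω : Ω) (j : ℕ) : ℝ :=
  (1 / (n : ℝ)) * ∑ i ∈ Finset.range n, if X i ω = j then 1 else 0

theorem summable_empiricalPmf_sq {Ω : Type*} (X : ℕ → Ω → ℕ) (n : ℕ) (ω : Ω) :
    Summable fun j => empiricalPmf X n ω j ^ 2 := by
  refine summable_of_ne_finset_zero (s := (Finset.range n).image fun i => X i ω) ?_
  intro j hj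
  have : ∀ i ∈ Finset.range n, (if X i ω = j then (1 : ℝ) else 0) = 0 := by
    intro i hi
    refine if_neg fun h => hj ?_
    exact Finset.mem_image.2 ⟨i, hi, h⟩
  simp [empiricalPmf, Finset.sum_eq_zero this]

/-! ### Localization to a window `{z, …, z'}` -/

/-- The sequence `(g z, …, g z')` is convex on `{a, …, b} ∩ {z, …, z'}`: its second differences
at three consecutive points of that set are nonnegative. -/
def IsConvexBetween {z z' : ℕ} (a b : ℕ) (g : Set.Icc z z' → ℝ) : Prop :=
  ∀ i j k : Set.Icc z z', a ≤ (i : ℕ) → (j : ℕ) = i + 1 → (k : ℕ) = i + 2 → (k : ℕ) ≤ b →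
    0 ≤ g k - 2 * g j + g i

/-- The convex sequences `(p z, …, p z')`. -/
def windowConvex (z z' : ℕ) : Set (Set.Icc z z' → ℝ) := {p | IsConvexBetween z z' p}

/-- The points `0 = s_0 < s_1 < … < s_m < s_(m+1) = S + 1`, where `s_1, …, s_m` are the knots of
`p` strictly between `0` and `S + 1`. -/
def breakpoints (p : ℕ → ℝ) (S : ℕ) : Set ℕ := {k | k = 0 ∨ k = S + 1 ∨ (k < S + 1 ∧ IsKnot p k)}

/-- `a = s_j` and `b = s_(j+1)` for some `j`. -/
def ConsecutiveBreakpoints (p : ℕ → ℝ) (S a b : ℕ) : Prop :=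
  a ∈ breakpoints p S ∧ b ∈ breakpoints p S ∧ a < b ∧ ∀ c ∈ breakpoints p S, ¬ (a < c ∧ c < b)

/-- The sequences `(g z, …, g z')` that are convex on `{s_j, …, s_(j+1)}` for all `j` with
`z ≤ s_j` and `s_(j+1) ≤ z'`. -/
def windowPiecewiseConvex (p : ℕ → ℝ) (S z z' : ℕ) : Set (Set.Icc z z' → ℝ) :=
  {g | ∀ a b, ConsecutiveBreakpoints p S a b → z ≤ a → b ≤ z' → IsConvexBetween a b g}

theorem isClosed_isConvexBetween {z z' : ℕ} (a b : ℕ) :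
    IsClosed {g : Set.Icc z z' → ℝ | IsConvexBetween a b g} := by
  simp only [IsConvexBetween, Set.ofPred_forall]
  refine isClosed_iInter fun i => isClosed_iInter fun j => isClosed_iInter fun k =>
    isClosed_iInter fun _ => isClosed_iInter fun _ => isClosed_iInter fun _ =>
    isClosed_iInter fun _ => isClosed_le continuous_const (by fun_prop)

theorem convex_isConvexBetween {z z' : ℕ} (a b : ℕ) :
    Convex ℝ {g : Set.Icc z z' → ℝ | IsConvexBetween a b g} := by
  intro p hp q hq c d hc hd _ i j k h1 h2 h3 h4
  have e1 := mul_nonneg hc (hp i j k h1 h2 h3 h4)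
  have e2 := mul_nonneg hd (hq i j k h1 h2 h3 h4)
  simp only [Pi.add_apply, Pi.smul_apply, smul_eq_mul]
  linarith

/-- The localized convex least-squares estimator: the minimizer of
`(1/2) ∑_{k=z}^{z'} (y k - p k)²` over the convex sequences `(p z, …, p z')`. -/
noncomputable def windowLSE (z z' : ℕ) (y : ℕ → ℝ) : Set.Icc z z' → ℝ :=
  leastSquares (windowConvex z z') fun j => y j

theorem existsUnique_windowLSE (z z' : ℕ) (y : ℕ → ℝ) :
    ∃! p, IsLeastSquares (windowConvex z z') (fun j => y j) p := by
  have h := existsUnique_isLeastSquares (windowConvex z z') (isClosed_isConvexBetween z z')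
    (convex_isConvexBetween z z') (by intro i j k _ _ _ _; simp) (fun j => y j)
    (Summable.of_finite)
  simpa [Summable.of_finite] using h

/-- The localized piecewise-convex projection: the minimizer of `(1/2) ∑_{k=z}^{z'} (w k - g k)²`
over the piecewise convex sequences `(g z, …, g z')`. -/
noncomputable def windowProj (p : ℕ → ℝ) (S z z' : ℕ) (w : ℕ → ℝ) : Set.Icc z z' → ℝ :=
  leastSquares (windowPiecewiseConvex p S z z') fun j => w j

theorem existsUnique_windowProj (p : ℕ → ℝ) (S z z' : ℕ) (w : ℕ → ℝ) :
    ∃! g, IsLeastSquares (windowPiecewiseConvex p S z z') (fun j => w j) g := by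
  have h := existsUnique_isLeastSquares (windowPiecewiseConvex p S z z')
    (by
      simp only [windowPiecewiseConvex, Set.ofPred_forall]
      exact isClosed_iInter fun a => isClosed_iInter fun b => isClosed_iInter fun _ =>
        isClosed_iInter fun _ => isClosed_iInter fun _ => isClosed_isConvexBetween a b)
    (by
      intro f hf g hg c d hc hd hcd a b h1 h2 h3
      exact convex_isConvexBetween a b (hf a b h1 h2 h3) (hg a b h1 h2 h3) hc hd hcd)
    (by intro a b _ _ _ i j k _ _ _ _; simp) (fun j => w j) (Summable.of_finite)
  simpa [Summable.of_finite] using h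

/-! ### The Gaussian limit -/

/-- `U`, restricted to `[0, 1]`, is a standard Brownian bridge: a centred Gaussian process with
covariance `s (1 - t)` for `s ≤ t` and almost surely continuous paths. -/
structure IsBrownianBridge {Ω : Type*} [MeasurableSpace Ω] (U : ℝ → Ω → ℝ) (P : Measure Ω) :
    Prop where
  gaussian : IsGaussianProcess (fun t : Set.Icc (0 : ℝ) 1 => U t) P
  mean_zero : ∀ t ∈ Set.Icc (0 : ℝ) 1, ∫ ω, U t ω ∂P = 0
  covariance : ∀ s ∈ Set.Icc (0 : ℝ) 1, ∀ t ∈ Set.Icc (0 : ℝ) 1, s ≤ t →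
    cov[U s, U t; P] = s * (1 - t)
  continuous_paths : ∀ᵐ ω ∂P, ContinuousOn (fun t => U t ω) (Set.Icc 0 1)

/-- The sum `p 0 + … + p (k - 1)`, which is the distribution function of `p` at `k - 1`
(and is `0` for `k = 0`). -/
def cdfBefore (p : ℕ → ℝ) (k : ℕ) : ℝ := ∑ j ∈ Finset.range k, p j

/-- The process `W(k) = U(F_p(k)) - U(F_p(k - 1))`. -/
def bridgeIncrement {Ω : Type*} (U : ℝ → Ω → ℝ) (p : ℕ → ℝ) (ω : Ω) (k : ℕ) : ℝ :=
  U (cdfBefore p (k + 1)) ω - U (cdfBefore p k) ω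

end ConvexPmf

/-! Near `p₀` only the constraints that are tight at `p₀` matter. Call `j ∈ {1, …, S}` flat if it is
not a knot, so that `laplacian p₀ j = 0`. If `q` is convex then `q - p₀` has nonnegative Laplacian
at the flat points. Relax the problem to the cone with just these constraints and let `g` be the
projection of `y - p₀` onto it. Then `p₀ + g` beats every convex sequence, so it is the estimator as
soon as it is convex. When `y` is close to `p₀`, `g` is small: at the flat points convexity comes
from `g`, at the knots the positive Laplacian of `p₀` absorbs `g`, and at `S + 2` it comes from `g
(S + 1) ≥ 0`. This applies to the global estimator on `{0, …, S + 1}` and to the localized one on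
its window (`eventually_convexAt_perturbOn`, `convexLSE_eq_perturbOn`, `windowLSE_eq_perturbOn`).

A constraint at `j` ties `j - 1`, `j`, `j + 1`, so the link between `t` and `t + 1` consists of the
constraints at `t` and `t + 1`. A double knot `t` removes both, and the relaxed problem splits there
(`IsWindowLS.restrict`). Hence all the projections considered agree on `{s, …, s'}` with the
piecewise-convex one (`eventually_lse_eq`). With the strong law this gives (i).

For (ii), the projection onto a closed convex cone is positively homogeneous and continuous, so the
rescaled error is almost surely eventually a fixed continuous function of `√n (p_n - p₀)`. The
multivariate central limit theorem, whose limit covariance is that of the bridge increments, the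
continuous mapping theorem and Slutsky's lemma conclude. -/

namespace ConvexPmf

open Topology

/-! ### Least squares over cones of sequences with nonnegative Laplacian on a prescribed set -/

/-- `g` has nonnegative Laplacian at the points of `A` interior to `{z, …, b}`. -/
def ConvexAt (A : Set ℕ) (z b : ℕ) (g : ℕ → ℝ) : Prop :=
  ∀ j, z < j → j < b → j ∈ A → 0 ≤ laplacian g j

/-- `g` minimizes `∑_{j=z}^{b} (y j - g j)²` among the sequences with nonnegative Laplacian at the
points of `A` interior to `{z, …, b}`. -/
def IsWindowLS (A : Set ℕ) (z b : ℕ) (y g : ℕ → ℝ) : Prop :=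
  ConvexAt A z b g ∧ ∀ q, ConvexAt A z b q →
    ∑ j ∈ Finset.Icc z b, (y j - g j) ^ 2 ≤ ∑ j ∈ Finset.Icc z b, (y j - q j) ^ 2

theorem lsCriterion_restrict (z b : ℕ) (y g : ℕ → ℝ) :
    lsCriterion (fun j : Set.Icc z b => y j) (fun j => g j) =
      (1 / 2) * ∑ j ∈ Finset.Icc z b, (y j - g j) ^ 2 := by
  rw [lsCriterion, tsum_fintype]
  congr 1
  exact (Finset.sum_subtype (Finset.Icc z b) (fun x => by simp) fun j => (y j - g j) ^ 2).symm

theorem exists_extension {z b : ℕ} (q : Set.Icc z b → ℝ) :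
    ∃ f : ℕ → ℝ, q = fun j : Set.Icc z b => f j := by
  classical
  exact ⟨fun j => if h : j ∈ Set.Icc z b then q ⟨j, h⟩ else 0, by ext ⟨j, hj⟩; simp [hj]⟩

/-- A set of sequences on the window described by Laplacians has the same least-squares problem. -/
theorem isLeastSquares_restrict_iff {A : Set ℕ} {z b : ℕ} {K : Set (Set.Icc z b → ℝ)}
    (hK : ∀ f : ℕ → ℝ, (fun j : Set.Icc z b => f j) ∈ K ↔ ConvexAt A z b f) (y g : ℕ → ℝ) :
    IsLeastSquares K (fun j => y j) (fun j => g j) ↔ IsWindowLS A z b y g := by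
  rw [IsLeastSquares, IsWindowLS, hK]
  refine and_congr_right fun _ => ⟨fun h q hq => ?_, fun h q hq => ?_⟩
  · have := h _ ((hK q).2 hq)
    rw [lsCriterion_restrict, lsCriterion_restrict] at this
    linarith
  · obtain ⟨f, rfl⟩ := exists_extension q
    have := h _ ((hK f).1 hq)
    rw [lsCriterion_restrict, lsCriterion_restrict]
    linarith

theorem isConvexBetween_restrict_iff {z b a c : ℕ} (f : ℕ → ℝ) :
    IsConvexBetween a c (fun j : Set.Icc z b => f j) ↔
      ∀ j, z < j → j < b → a < j → j < c → 0 ≤ laplacian f j := by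
  constructor
  · intro h j h1 h2 h3 h4
    have := h ⟨j - 1, by constructor <;> omega⟩ ⟨j, by constructor <;> omega⟩
      ⟨j + 1, by constructor <;> omega⟩ (by simp; omega) (by simp; omega) (by simp; omega)
      (by simp; omega)
    simpa [laplacian] using this
  · rintro h ⟨i, hi⟩ ⟨j, hj⟩ ⟨k, hk⟩ h1 h2 h3 h4
    simp only at h1 h2 h3 h4 ⊢
    subst h2 h3
    have := h (i + 1) (by have := hi.1; omega) (by have := hk.2; omega) (by omega) (by omega)
    simpa [laplacian] using this

theorem windowConvex_restrict_iff {z b : ℕ} (f : ℕ → ℝ) :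
    (fun j : Set.Icc z b => f j) ∈ windowConvex z b ↔ ConvexAt Set.univ z b f := by
  rw [windowConvex, Set.mem_ofPred_eq, isConvexBetween_restrict_iff]
  exact ⟨fun h j h1 h2 _ => h j h1 h2 h1 h2, fun h j h1 h2 _ _ => h j h1 h2 trivial⟩

/-- The points strictly between two consecutive breakpoints lying in `{z, …, z'}`. -/
def segmentInteriors (p : ℕ → ℝ) (S z z' : ℕ) : Set ℕ :=
  {j | ∃ a b, ConsecutiveBreakpoints p S a b ∧ z ≤ a ∧ b ≤ z' ∧ a < j ∧ j < b}

theorem windowPiecewiseConvex_restrict_iff {p : ℕ → ℝ} {S z z' : ℕ} (f : ℕ → ℝ) :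
    (fun j : Set.Icc z z' => f j) ∈ windowPiecewiseConvex p S z z' ↔
      ConvexAt (segmentInteriors p S z z') z z' f := by
  rw [windowPiecewiseConvex, Set.mem_ofPred_eq]
  simp only [isConvexBetween_restrict_iff]
  constructor
  · rintro h j h1 h2 ⟨a, b, hab, h3, h4, h5, h6⟩
    exact h a b hab h3 h4 j h1 h2 h5 h6
  · intro h a b hab h3 h4 j h1 h2 h5 h6
    exact h j h1 h2 ⟨a, b, hab, h3, h4, h5, h6⟩

theorem windowLSE_eq {z z' : ℕ} {y g : ℕ → ℝ} (h : IsWindowLS Set.univ z z' y g) :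
    windowLSE z z' y = fun j : Set.Icc z z' => g j :=
  (existsUnique_windowLSE z z' y).unique
    (leastSquares_spec (existsUnique_windowLSE z z' y).exists)
    ((isLeastSquares_restrict_iff windowConvex_restrict_iff y g).2 h)

theorem isWindowLS_windowProj (p : ℕ → ℝ) (S z z' : ℕ) (w : ℕ → ℝ) :
    ∃ g, IsWindowLS (segmentInteriors p S z z') z z' w g ∧
      windowProj p S z z' w = fun j : Set.Icc z z' => g j := by
  obtain ⟨g, hg⟩ := exists_extension (windowProj p S z z' w)
  refine ⟨g, ?_, hg⟩
  rw [← isLeastSquares_restrict_iff windowPiecewiseConvex_restrict_iff, ← hg]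
  exact leastSquares_spec (existsUnique_windowProj p S z z' w).exists

theorem exists_isWindowLS (A : Set ℕ) (z b : ℕ) (y : ℕ → ℝ) : ∃ g, IsWindowLS A z b y g := by
  let K : Set (Set.Icc z b → ℝ) := {q | ∀ i j k : Set.Icc z b, (j : ℕ) = i + 1 →
    (k : ℕ) = i + 2 → (j : ℕ) ∈ A → 0 ≤ q k - 2 * q j + q i}
  have hK : ∀ f : ℕ → ℝ, (fun j : Set.Icc z b => f j) ∈ K ↔ ConvexAt A z b f := by
    intro f
    constructor
    · intro h j h1 h2 hA
      have := h ⟨j - 1, by constructor <;> omega⟩ ⟨j, by constructor <;> omega⟩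
        ⟨j + 1, by constructor <;> omega⟩ (by simp; omega) (by simp; omega) hA
      simpa [laplacian] using this
    · rintro h ⟨i, hi⟩ ⟨j, hj⟩ ⟨k, hk⟩ h2 h3 h4
      simp only at h2 h3 h4 ⊢
      subst h2 h3
      have := h (i + 1) (by have := hi.1; omega) (by have := hk.2; omega) h4
      simpa [laplacian] using this
  have hcl : IsClosed K := by
    simp only [K, Set.ofPred_forall]
    exact isClosed_iInter fun i => isClosed_iInter fun j => isClosed_iInter fun k =>
      isClosed_iInter fun _ => isClosed_iInter fun _ => isClosed_iInter fun _ =>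
      isClosed_le continuous_const (by fun_prop)
  have hconv : Convex ℝ K := by
    intro f hf q hq c d hc hd _ i j k h1 h2 h3
    have e1 := mul_nonneg hc (hf i j k h1 h2 h3)
    have e2 := mul_nonneg hd (hq i j k h1 h2 h3)
    simp only [Pi.add_apply, Pi.smul_apply, smul_eq_mul]
    linarith
  obtain ⟨q, hq, -⟩ := existsUnique_isLeastSquares K hcl hconv (by intro i j k _ _ _; simp)
    (fun j => y j) Summable.of_finite
  obtain ⟨f, rfl⟩ := exists_extension q
  refine ⟨f, (isLeastSquares_restrict_iff hK y f).1 ?_⟩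
  simpa [Summable.of_finite] using hq

theorem laplacian_congr {f g : ℕ → ℝ} {j : ℕ} (h0 : f (j - 1) = g (j - 1)) (h1 : f j = g j)
    (h2 : f (j + 1) = g (j + 1)) : laplacian f j = laplacian g j := by
  simp only [laplacian, h0, h1, h2]

/-- Strict convexity of the criterion, via the parallelogram identity at the midpoint of two
minimizers. Values outside the window are unconstrained. -/
theorem IsWindowLS.eq_of_mem {A : Set ℕ} {z b : ℕ} {y f g : ℕ → ℝ} (hf : IsWindowLS A z b y f)
    (hg : IsWindowLS A z b y g) {k : ℕ} (h1 : z ≤ k) (h2 : k ≤ b) : f k = g k := by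
  have hm : ConvexAt A z b fun j => (f j + g j) / 2 := by
    intro j h1 h2 hA
    have e1 := hf.1 j h1 h2 hA
    have e2 := hg.1 j h1 h2 hA
    simp only [laplacian] at *
    linarith
  have e1 := hf.2 _ hm
  have e2 := hg.2 _ hm
  have e3 : ∑ j ∈ Finset.Icc z b, (f j - g j) ^ 2 ≤ 0 := by
    have : ∑ j ∈ Finset.Icc z b, (f j - g j) ^ 2 =
        2 * ∑ j ∈ Finset.Icc z b, (y j - f j) ^ 2 + 2 * ∑ j ∈ Finset.Icc z b, (y j - g j) ^ 2 -
          4 * ∑ j ∈ Finset.Icc z b, (y j - (f j + g j) / 2) ^ 2 := by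
      simp only [Finset.mul_sum, ← Finset.sum_add_distrib, ← Finset.sum_sub_distrib]
      exact Finset.sum_congr rfl fun j _ => by ring
    linarith
  have e4 := Finset.single_le_sum (f := fun j => (f j - g j) ^ 2) (fun j _ => sq_nonneg _)
    (Finset.mem_Icc.2 ⟨h1, h2⟩)
  have e5 : (f k - g k) ^ 2 = 0 := le_antisymm (by simpa using e4.trans e3) (sq_nonneg _)
  exact sub_eq_zero.1 (pow_eq_zero_iff two_ne_zero |>.1 e5)

/-- Where the constraints across the two ends of a subwindow are absent, the least-squares problem
decouples. -/
theorem IsWindowLS.restrict {A A' : Set ℕ} {z b s c : ℕ} {y g : ℕ → ℝ}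
    (h : IsWindowLS A z b y g) (hs : z ≤ s) (hc : c ≤ b)
    (hA : ∀ j, s < j → j < c → (j ∈ A ↔ j ∈ A'))
    (hs' : z < s → s - 1 ∉ A ∧ s ∉ A) (hc' : c < b → c ∉ A ∧ c + 1 ∉ A) :
    IsWindowLS A' s c y g := by
  refine ⟨fun j h1 h2 hj => h.1 j (by omega) (by omega) ((hA j h1 h2).2 hj), fun q hq => ?_⟩
  classical
  -- Splice the competitor `q` into `g`. The only constraints mixing points inside and outside `{s,
  -- …, c}` sit at `s - 1`, `s`, `c` and `c + 1`, and these are absent.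
  let r : ℕ → ℝ := fun j => if s ≤ j ∧ j ≤ c then q j else g j
  have hr : ConvexAt A z b r := by
    intro j h1 h2 hj
    by_cases hin : s < j ∧ j < c
    · rw [laplacian_congr (g := q) (if_pos (by omega)) (if_pos (by omega)) (if_pos (by omega))]
      exact hq j hin.1 hin.2 ((hA j hin.1 hin.2).1 hj)
    · by_cases hsc : s ≤ c
      · have n1 : j ≠ s := by
          rintro rfl
          exact (hs' h1).2 hj
        have n2 : j ≠ s - 1 := by
          rintro rfl
          exact (hs' (by omega)).1 hj
        have n3 : j ≠ c := by
          rintro rfl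
          exact (hc' h2).1 hj
        have n4 : j ≠ c + 1 := by
          rintro rfl
          exact (hc' (by omega)).2 hj
        rw [laplacian_congr (g := g) (if_neg (by omega)) (if_neg (by omega)) (if_neg (by omega))]
        exact h.1 j h1 h2 hj
      · rw [laplacian_congr (g := g) (if_neg (by omega)) (if_neg (by omega)) (if_neg (by omega))]
        exact h.1 j h1 h2 hj
  have hsub : Finset.Icc s c ⊆ Finset.Icc z b := Finset.Icc_subset_Icc hs hc
  have e := h.2 r hr
  rw [← Finset.sum_sdiff hsub, ← Finset.sum_sdiff hsub] at e
  have e1 : ∑ j ∈ Finset.Icc z b \ Finset.Icc s c, (y j - r j) ^ 2 =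
      ∑ j ∈ Finset.Icc z b \ Finset.Icc s c, (y j - g j) ^ 2 := by
    refine Finset.sum_congr rfl fun j hj => ?_
    have : ¬ (s ≤ j ∧ j ≤ c) := by simpa using (Finset.mem_sdiff.1 hj).2
    simp [r, if_neg this]
  have e2 : ∑ j ∈ Finset.Icc s c, (y j - r j) ^ 2 = ∑ j ∈ Finset.Icc s c, (y j - q j) ^ 2 := by
    refine Finset.sum_congr rfl fun j hj => ?_
    simp [r, if_pos (Finset.mem_Icc.1 hj)]
  linarith

theorem IsWindowLS.eq_of_singleton {A : Set ℕ} {k : ℕ} {y g : ℕ → ℝ}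
    (h : IsWindowLS A k k y g) : g k = y k := by
  have e := h.2 y fun j h1 h2 _ => absurd h2 (by omega)
  simp only [Finset.Icc_self, Finset.sum_singleton, sub_self] at e
  have : (y k - g k) ^ 2 = 0 := le_antisymm (by simpa using e) (sq_nonneg _)
  exact (sub_eq_zero.1 (pow_eq_zero_iff two_ne_zero |>.1 this)).symm

/-- Comparison with the competitor `0`; the constant 4 comes from `g² ≤ 2 y² + 2 (y - g)²`. It makes
the projection of small data small. -/
theorem IsWindowLS.sq_le {A : Set ℕ} {z b : ℕ} {y g : ℕ → ℝ} (h : IsWindowLS A z b y g)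
    {k : ℕ} (h1 : z ≤ k) (h2 : k ≤ b) : g k ^ 2 ≤ 4 * ∑ j ∈ Finset.Icc z b, y j ^ 2 := by
  have e := h.2 0 fun j _ _ _ => by simp [laplacian]
  simp only [Pi.zero_apply, sub_zero] at e
  have e1 := Finset.single_le_sum (f := fun j => g j ^ 2) (fun j _ => sq_nonneg _)
    (Finset.mem_Icc.2 ⟨h1, h2⟩)
  have e2 : ∑ j ∈ Finset.Icc z b, g j ^ 2 ≤
      2 * ∑ j ∈ Finset.Icc z b, y j ^ 2 + 2 * ∑ j ∈ Finset.Icc z b, (y j - g j) ^ 2 := by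
    simp only [Finset.mul_sum, ← Finset.sum_add_distrib]
    exact Finset.sum_le_sum fun j _ => by nlinarith [sq_nonneg (2 * y j - g j)]
  linarith

/-- At the right end of the window the projection lies above the data. -/
theorem IsWindowLS.le_right {A : Set ℕ} {z b : ℕ} {y g : ℕ → ℝ} (h : IsWindowLS A z b y g)
    (hzb : z ≤ b) : y b ≤ g b := by
  by_contra! hlt
  -- Raising the last value keeps the constraints, since `g b` enters only the one at `b - 1`, with
  -- coefficient `+1`.
  have hr : ConvexAt A z b (Function.update g b (y b)) := by
    intro j h1 h2 hj
    have e := h.1 j h1 h2 hj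
    simp only [laplacian] at *
    rw [Function.update_of_ne (show j - 1 ≠ b by omega), Function.update_of_ne (show j ≠ b by omega)]
    by_cases hb : j + 1 = b
    · rw [hb] at e ⊢
      rw [Function.update_self]
      linarith
    · rwa [Function.update_of_ne hb]
  have e := h.2 _ hr
  rw [← Finset.add_sum_erase _ _ (Finset.right_mem_Icc.2 hzb),
    ← Finset.add_sum_erase _ _ (Finset.right_mem_Icc.2 hzb), Function.update_self] at e
  have e1 : ∑ j ∈ (Finset.Icc z b).erase b, (y j - Function.update g b (y b) j) ^ 2 =
      ∑ j ∈ (Finset.Icc z b).erase b, (y j - g j) ^ 2 :=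
    Finset.sum_congr rfl fun j hj => by rw [Function.update_of_ne (Finset.ne_of_mem_erase hj)]
  rw [e1] at e
  nlinarith

/-! ### The estimators near a compactly supported convex sequence -/

/-- The points of `{1, …, S}` at which `p` has no knot. -/
def flatPoints (p : ℕ → ℝ) (S : ℕ) : Set ℕ := {j | 1 ≤ j ∧ j ≤ S ∧ ¬ IsKnot p j}

theorem laplacian_add (f g : ℕ → ℝ) (j : ℕ) :
    laplacian (f + g) j = laplacian f j + laplacian g j := by
  simp only [laplacian, Pi.add_apply]
  ring

theorem laplacian_sub (f g : ℕ → ℝ) (j : ℕ) :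
    laplacian (f - g) j = laplacian f j - laplacian g j := by
  simp only [laplacian, Pi.sub_apply]
  ring

theorem tendsto_laplacian {ι : Type*} {l : Filter ι} {f : ι → ℕ → ℝ} {p : ℕ → ℝ}
    (h : ∀ j, Tendsto (fun n => f n j) l (𝓝 (p j))) (j : ℕ) :
    Tendsto (fun n => laplacian (f n) j) l (𝓝 (laplacian p j)) :=
  ((h _).sub ((h _).const_mul 2)).add (h _)

/-- The sequence `p + g` on `{z, …, b}` and `p` elsewhere. -/
noncomputable def perturbOn (p g : ℕ → ℝ) (z b : ℕ) : ℕ → ℝ :=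
  p + (Set.Icc z b).indicator g

theorem perturbOn_of_mem {p g : ℕ → ℝ} {z b j : ℕ} (h1 : z ≤ j) (h2 : j ≤ b) :
    perturbOn p g z b j = p j + g j := by
  have : j ∈ Set.Icc z b := ⟨h1, h2⟩
  simp [perturbOn, this]

theorem perturbOn_of_lt {p g : ℕ → ℝ} {z b j : ℕ} (h : b < j) :
    perturbOn p g z b j = p j := by
  have : j ∉ Set.Icc z b := fun h' => absurd h'.2 (by omega)
  simp [perturbOn, this]

/-- A nonnegative convex sequence with support `{0, …, S}`. -/
structure IsConvexWithSupport (p : ℕ → ℝ) (S : ℕ) : Prop where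
  laplacian_nonneg : ∀ j, 1 ≤ j → 0 ≤ laplacian p j
  nonneg : ∀ j, 0 ≤ p j
  support_eq : Function.support p = Set.Iic S

namespace IsConvexWithSupport

variable {p : ℕ → ℝ} {S : ℕ}

theorem eq_zero (hp : IsConvexWithSupport p S) {j : ℕ} (hj : S < j) : p j = 0 := by
  by_contra h
  have : j ∈ Function.support p := h
  rw [hp.support_eq] at this
  exact absurd this (by simpa using hj)

theorem laplacian_eq_zero (hp : IsConvexWithSupport p S) {j : ℕ} (hj : S + 1 < j) :
    laplacian p j = 0 := by
  simp [laplacian, hp.eq_zero (show S < j + 1 by omega), hp.eq_zero (show S < j by omega),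
    hp.eq_zero (show S < j - 1 by omega)]

theorem isKnot_le (hp : IsConvexWithSupport p S) {j : ℕ} (hj : IsKnot p j) : j ≤ S + 1 := by
  by_contra! h
  exact absurd hj.2 (by rw [hp.laplacian_eq_zero h]; exact lt_irrefl _)

theorem laplacian_succ_pos (hp : IsConvexWithSupport p S) : 0 < laplacian p (S + 1) := by
  have h1 : S ∈ Function.support p := by
    rw [hp.support_eq]
    exact Set.self_mem_Iic
  have h2 := lt_of_le_of_ne (hp.nonneg S) (Ne.symm h1)
  simpa [laplacian, hp.eq_zero (show S < S + 1 by omega),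
    hp.eq_zero (show S < S + 1 + 1 by omega)] using h2

theorem mem_flatPoints (hp : IsConvexWithSupport p S) {j : ℕ} (h1 : 1 ≤ j) (h2 : j ≤ S + 1)
    (h3 : ¬ IsKnot p j) : j ∈ flatPoints p S := by
  refine ⟨h1, ?_, h3⟩
  by_contra h
  obtain rfl : j = S + 1 := by omega
  exact h3 ⟨h1, hp.laplacian_succ_pos⟩

theorem laplacian_flat (hp : IsConvexWithSupport p S) {j : ℕ} (hj : j ∈ flatPoints p S) :
    laplacian p j = 0 :=
  le_antisymm (not_lt.1 fun h => hj.2.2 ⟨hj.1, h⟩) (hp.laplacian_nonneg j hj.1)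

/-- Projections of vanishing perturbations onto the cone of sequences convex between the knots
eventually give convex sequences. -/
theorem eventually_convexAt_perturbOn (hp : IsConvexWithSupport p S) {ι : Type*} {l : Filter ι}
    {d g : ι → ℕ → ℝ} {z b : ℕ} (hb : b ≤ S + 1) (hd : ∀ j, Tendsto (fun n => d n j) l (𝓝 0))
    (hd0 : ∀ n, d n (S + 1) = 0) (hg : ∀ n, IsWindowLS (flatPoints p S) z b (d n) (g n)) :
    ∀ᶠ n in l, ∀ j, z < j → (j < b ∨ b = S + 1) → 0 ≤ laplacian (perturbOn p (g n) z b) j := by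
  have hlim : ∀ j, Tendsto (fun n => perturbOn p (g n) z b j) l (𝓝 (p j)) := by
    intro j
    by_cases hj : z ≤ j ∧ j ≤ b
    · simp only [perturbOn_of_mem hj.1 hj.2]
      have h1 : Tendsto (fun n => 4 * ∑ j ∈ Finset.Icc z b, d n j ^ 2) l (𝓝 0) := by
        have := (tendsto_finsetSum (Finset.Icc z b) fun j _ => (hd j).pow 2).const_mul 4
        simpa using this
      have h2 : Tendsto (fun n => g n j ^ 2) l (𝓝 0) :=
        squeeze_zero (fun n => sq_nonneg _) (fun n => (hg n).sq_le hj.1 hj.2) h1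
      have h3 : Tendsto (fun n => |g n j|) l (𝓝 0) := by
        simpa [Real.sqrt_sq_eq_abs] using h2.sqrt
      simpa using ((tendsto_zero_iff_abs_tendsto_zero _).2 h3).const_add (p j)
    · have : j ∉ Set.Icc z b := hj
      simp only [perturbOn, Pi.add_apply, Set.indicator_of_notMem this, add_zero]
      exact tendsto_const_nhds
  -- All knots are at most `S + 1`, so finitely many strict inequalities have to survive the limit.
  have hknots : ∀ᶠ n in l, ∀ j ∈ Finset.range (S + 2), 0 < laplacian p j →
      0 < laplacian (perturbOn p (g n) z b) j := by
    rw [eventually_all_finset]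
    intro j _
    by_cases hj : 0 < laplacian p j
    · filter_upwards [(tendsto_laplacian hlim j).eventually_const_lt hj] with n hn _ using hn
    · exact Eventually.of_forall fun n h => absurd h hj
  filter_upwards [hknots] with n hn j hzj hjb
  by_cases hk : IsKnot p j
  · exact (hn j (by have := hp.isKnot_le hk; simp; omega) hk.2).le
  by_cases hjS : j ≤ S + 1
  · have hj := hp.mem_flatPoints (by omega) hjS hk
    have hjb' : j < b := by
      have := hj.2.1
      omega
    rw [laplacian_congr (g := p + g n) (perturbOn_of_mem (by omega) (by omega))
      (perturbOn_of_mem (by omega) (by omega)) (perturbOn_of_mem (by omega) (by omega)),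
      laplacian_add, hp.laplacian_flat hj, zero_add]
    exact (hg n).1 j hzj hjb' hj
  -- Beyond `S + 1` the Laplacian at `j` reduces to the value at `j - 1`. This is `0` except at `j =
  -- S + 2`, where it is the last value of the projection, which lies above the datum `0`.
  · obtain rfl : b = S + 1 := by omega
    rw [laplacian, perturbOn_of_lt (show S + 1 < j + 1 by omega),
      perturbOn_of_lt (show S + 1 < j by omega), hp.eq_zero (show S < j + 1 by omega),
      hp.eq_zero (show S < j by omega)]
    simp only [mul_zero, sub_zero, zero_add]
    by_cases hj2 : S + 1 < j - 1
    · rw [perturbOn_of_lt hj2, hp.eq_zero (by omega)]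
    · have e : j - 1 = S + 1 := by omega
      rw [e, perturbOn_of_mem (by omega) le_rfl, hp.eq_zero (by omega), zero_add, ← hd0 n]
      exact (hg n).le_right (by omega)

/-- The relaxation: subtracting `p` from a convex `q` leaves a competitor for `g`, because `p` has
zero Laplacian at the flat points. -/
theorem sum_perturbOn_le (hp : IsConvexWithSupport p S) {y g q : ℕ → ℝ} {z b : ℕ}
    (hg : IsWindowLS (flatPoints p S) z b (y - p) g)
    (hq : ∀ j, z < j → j < b → 0 ≤ laplacian q j) :
    ∑ j ∈ Finset.Icc z b, (y j - perturbOn p g z b j) ^ 2 ≤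
      ∑ j ∈ Finset.Icc z b, (y j - q j) ^ 2 := by
  have e := hg.2 (q - p) fun j h1 h2 hj => by
    rw [laplacian_sub, hp.laplacian_flat hj, sub_zero]
    exact hq j h1 h2
  calc ∑ j ∈ Finset.Icc z b, (y j - perturbOn p g z b j) ^ 2
      = ∑ j ∈ Finset.Icc z b, ((y - p) j - g j) ^ 2 := by
        refine Finset.sum_congr rfl fun j hj => ?_
        rw [Finset.mem_Icc] at hj
        rw [perturbOn_of_mem hj.1 hj.2, Pi.sub_apply]
        ring
    _ ≤ _ := e
    _ = _ := Finset.sum_congr rfl fun j _ => by simp only [Pi.sub_apply]; ring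

/-- The data and `perturbOn p g 0 (S + 1)` both vanish beyond `S + 1`, so its criterion is a finite
sum, while a competitor's can only gain from the tail. -/
theorem convexLSE_eq_perturbOn (hp : IsConvexWithSupport p S) {y g : ℕ → ℝ}
    (hy : ∀ j, S < j → y j = 0) (hg : IsWindowLS (flatPoints p S) 0 (S + 1) (y - p) g)
    (hconv : ∀ j, 0 < j → 0 ≤ laplacian (perturbOn p g 0 (S + 1)) j) :
    convexLSE y = perturbOn p g 0 (S + 1) := by
  have hE : ∀ j ∉ Finset.Icc 0 (S + 1), perturbOn p g 0 (S + 1) j = 0 := by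
    intro j hj
    have : S + 1 < j := by simpa using hj
    rw [perturbOn_of_lt this, hp.eq_zero (by omega)]
  have hy' : ∀ j ∉ Finset.Icc 0 (S + 1), y j = 0 := fun j hj => hy j (by simp at hj; omega)
  have hysum : Summable fun j => y j ^ 2 :=
    summable_of_ne_finset_zero (s := Finset.Icc 0 (S + 1)) fun j hj => by simp [hy' j hj]
  refine (existsUnique_convexLSE y hysum).unique
    (leastSquares_spec (existsUnique_convexLSE y hysum).exists) ⟨⟨hconv, ?_⟩, ?_⟩
  · exact summable_of_ne_finset_zero (s := Finset.Icc 0 (S + 1)) fun j hj => by simp [hE j hj]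
  · rintro q ⟨hq, hqs⟩
    have hs : Summable fun j => (y j - q j) ^ 2 :=
      Summable.of_nonneg_of_le (fun j => sq_nonneg _)
        (fun j => by nlinarith [sq_nonneg (y j + q j)]) ((hysum.mul_left 2).add (hqs.mul_left 2))
    rw [lsCriterion, lsCriterion]
    refine mul_le_mul_of_nonneg_left ?_ (by norm_num)
    rw [tsum_eq_sum (s := Finset.Icc 0 (S + 1)) fun j hj => by rw [hE j hj, hy' j hj]; norm_num]
    exact (hp.sum_perturbOn_le hg fun j h1 _ => hq j h1).trans
      (hs.sum_le_tsum _ fun j _ => sq_nonneg _)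

theorem windowLSE_eq_perturbOn (hp : IsConvexWithSupport p S) {y g : ℕ → ℝ} {z z' b : ℕ}
    (hb : b = min z' (S + 1))
    (hy : ∀ j, S < j → y j = 0) (hg : IsWindowLS (flatPoints p S) z b (y - p) g)
    (hconv : ∀ j, z < j → (j < b ∨ b = S + 1) → 0 ≤ laplacian (perturbOn p g z b) j) :
    windowLSE z z' y = fun j : Set.Icc z z' => perturbOn p g z b j := by
  refine windowLSE_eq (g := perturbOn p g z b)
    ⟨fun j h1 h2 _ => hconv j h1 (by omega), fun q hq => ?_⟩
  have hsub : Finset.Icc z b ⊆ Finset.Icc z z' := Finset.Icc_subset_Icc le_rfl (by omega)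
  rw [← Finset.sum_subset hsub]
  · refine (hp.sum_perturbOn_le hg fun j h1 h2 => hq j h1 (by omega) trivial).trans ?_
    exact Finset.sum_le_sum_of_subset_of_nonneg hsub fun j _ _ => sq_nonneg _
  · intro j h1 h2
    rw [Finset.mem_Icc] at h1 h2
    rw [perturbOn_of_lt (by omega), hp.eq_zero (by omega), hy j (by omega)]
    norm_num

/-- Between two breakpoints, the flat points are the interiors of the segments. -/
theorem mem_segmentInteriors_iff (hp : IsConvexWithSupport p S) {z z' s c : ℕ} (hzs : z ≤ s)
    (hcz : c ≤ z') (hs : s ∈ breakpoints p S) (hc : c ∈ breakpoints p S) {j : ℕ}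
    (h1 : s < j) (h2 : j < c) : j ∈ segmentInteriors p S z z' ↔ j ∈ flatPoints p S := by
  classical
  have hbp : ∀ i ∈ breakpoints p S, i ≤ S + 1 := by
    rintro i (rfl | rfl | h) <;> omega
  have hflat : ∀ i, i ∉ breakpoints p S → i ≤ S + 1 → i ∈ flatPoints p S := by
    intro i hi hiS
    have h0 : i ≠ 0 := fun h => hi (Or.inl h)
    refine hp.mem_flatPoints (by omega) hiS fun hk => hi ?_
    rcases hiS.lt_or_eq with h | h
    · exact Or.inr (Or.inr ⟨h, hk⟩)
    · exact Or.inr (Or.inl h)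
  have hcS := hbp c hc
  constructor
  · rintro ⟨a, b, ⟨-, -, -, hab⟩, -, -, h3, h4⟩
    exact hflat j (fun h => hab j h ⟨h3, h4⟩) (by omega)
  · intro hj
    have hjb : j ∉ breakpoints p S := by
      rintro (h | h | h)
      · omega
      · have := hj.2.1
        omega
      · exact hj.2.2 h.2
    -- Take the nearest breakpoints on either side of `j`. They stay within `{s, …, c}`, hence in
    -- the window, because `s` and `c` are themselves breakpoints.
    obtain ⟨b, ⟨hb1, hb2⟩, hb3⟩ : ∃ b, (b ∈ breakpoints p S ∧ j < b) ∧
        ∀ i, i ∈ breakpoints p S ∧ j < i → b ≤ i :=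
      have hex : ∃ b, b ∈ breakpoints p S ∧ j < b := ⟨c, hc, h2⟩
      ⟨Nat.find hex, Nat.find_spec hex, fun i hi => Nat.find_min' hex hi⟩
    have hsa : s ≤ Nat.findGreatest (fun i => i ∈ breakpoints p S) j :=
      Nat.le_findGreatest h1.le hs
    have ha := Nat.findGreatest_spec (P := fun i => i ∈ breakpoints p S) h1.le hs
    have haj := Nat.findGreatest_le (P := fun i => i ∈ breakpoints p S) j
    set a := Nat.findGreatest (fun i => i ∈ breakpoints p S) j with ha_def
    have haj' : a ≠ j := fun h => hjb (h ▸ ha)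
    refine ⟨a, b, ⟨ha, hb1, by omega, fun i hi hi' => ?_⟩, by omega,
      (hb3 c ⟨hc, h2⟩).trans hcz, by omega, hb2⟩
    rcases lt_trichotomy i j with h | rfl | h
    · have := Nat.le_findGreatest (P := fun i => i ∈ breakpoints p S) h.le hi
      omega
    · exact hjb hi
    · have := hb3 i ⟨hi, h⟩
      omega

/-- The inclusion can be strict: flat points on a segment that the window cuts carry no constraint.
-/
theorem segmentInteriors_subset (hp : IsConvexWithSupport p S) {z z' : ℕ} :
    segmentInteriors p S z z' ⊆ flatPoints p S := by
  rintro j ⟨a, b, ⟨ha, hb, h0, hab⟩, h1, h2, h3, h4⟩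
  exact (hp.mem_segmentInteriors_iff le_rfl le_rfl ha hb h3 h4).1
    ⟨a, b, ⟨ha, hb, h0, hab⟩, le_rfl, le_rfl, h3, h4⟩

/-- Near `p`, the convex least-squares estimator and its localized version are both given on
`{s, …, s'}` by the localized piecewise-convex projection. -/
theorem eventually_lse_eq (hp : IsConvexWithSupport p S) {ι : Type*} {l : Filter ι}
    {y : ι → ℕ → ℝ} (hy : ∀ j, Tendsto (fun n => y n j) l (𝓝 (p j)))
    (hy0 : ∀ n j, S < j → y n j = 0) {s s' z z' : ℕ}
    (hs : s = 0 ∨ ∃ t, s = t + 1 ∧ IsDoubleKnot p t) (hs' : IsDoubleKnot p s' ∨ S + 1 ≤ s')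
    (hz : z ≤ s) (hz' : s' ≤ z') :
    ∀ᶠ n in l, ∀ k (h1 : s ≤ k) (h2 : k ≤ s'),
      convexLSE (y n) k = p k + windowProj p S z z' (y n - p) ⟨k, hz.trans h1, h2.trans hz'⟩ ∧
      windowLSE z z' (y n) ⟨k, hz.trans h1, h2.trans hz'⟩ =
        p k + windowProj p S z z' (y n - p) ⟨k, hz.trans h1, h2.trans hz'⟩ := by
  have hd : ∀ j, Tendsto (fun n => (y n - p) j) l (𝓝 0) := fun j => by
    simpa using (hy j).sub_const (p j)
  have hd0 : ∀ n j, S < j → (y n - p) j = 0 := fun n j hj => by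
    simp [hy0 n j hj, hp.eq_zero hj]
  choose f hf using fun n => exists_isWindowLS (flatPoints p S) 0 (S + 1) (y n - p)
  choose g hg using fun n => exists_isWindowLS (flatPoints p S) z (min z' (S + 1)) (y n - p)
  choose h hh hh' using fun n => isWindowLS_windowProj p S z z' (y n - p)
  have hsS : s ≤ S + 1 := by
    rcases hs with h | ⟨t, rfl, ht⟩
    · omega
    · exact hp.isKnot_le ht.2
  have hsflat : ∀ i, i < s → s - 1 ∉ flatPoints p S ∧ s ∉ flatPoints p S := by
    rintro i hi
    rcases hs with h | ⟨t, rfl, ht⟩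
    · omega
    · exact ⟨fun h => h.2.2 ht.1, fun h => h.2.2 ht.2⟩
  -- The right cut. If `s'` exceeds `S + 1`, it is made at `S + 1`, since neither `S + 1` nor `S +
  -- 2` is flat.
  obtain ⟨c, hc⟩ : ∃ c, c = min s' (S + 1) := ⟨_, rfl⟩
  have hcflat : c ∉ flatPoints p S ∧ c + 1 ∉ flatPoints p S := by
    by_cases hcS : c = S + 1
    · exact ⟨fun h => absurd h.2.1 (by omega), fun h => absurd h.2.1 (by omega)⟩
    · obtain rfl : c = s' := by omega
      rcases hs' with h | h
      · exact ⟨fun h' => h'.2.2 h.1, fun h' => h'.2.2 h.2⟩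
      · omega
  have hsb : s ∈ breakpoints p S := by
    rcases hs with h | ⟨t, rfl, ht⟩
    · exact Or.inl h
    · rcases hsS.lt_or_eq with h | h
      · exact Or.inr (Or.inr ⟨h, ht.2⟩)
      · exact Or.inr (Or.inl h)
  have hcb : c ∈ breakpoints p S := by
    by_cases hcS : c = S + 1
    · exact Or.inr (Or.inl hcS)
    · obtain rfl : c = s' := by omega
      rcases hs' with h | h
      · exact Or.inr (Or.inr ⟨by omega, h.1⟩)
      · omega
  filter_upwards [hp.eventually_convexAt_perturbOn le_rfl hd (fun n => hd0 n _ (by omega)) hf,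
    hp.eventually_convexAt_perturbOn (min_le_right _ _) hd (fun n => hd0 n _ (by omega)) hg]
    with n h1 h2 k hsk hks
  rw [hp.convexLSE_eq_perturbOn (hy0 n) (hf n) fun j hj => h1 j hj (Or.inr rfl),
    hp.windowLSE_eq_perturbOn rfl (hy0 n) (hg n) h2, hh' n]
  simp only
  -- On `{s, …, c}` the three projections solve the same restricted problem, so uniqueness
  -- identifies them.
  by_cases hkc : k ≤ c
  · have r1 : IsWindowLS (flatPoints p S) s c (y n - p) (f n) :=
      (hf n).restrict (by omega) (by omega) (fun _ _ _ => Iff.rfl) (hsflat 0) fun _ => hcflat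
    have r2 : IsWindowLS (flatPoints p S) s c (y n - p) (g n) :=
      (hg n).restrict (by omega) (by omega) (fun _ _ _ => Iff.rfl) (hsflat z) fun _ => hcflat
    have r3 : IsWindowLS (flatPoints p S) s c (y n - p) (h n) :=
      (hh n).restrict (by omega) (by omega)
        (fun j => hp.mem_segmentInteriors_iff hz (by omega) hsb hcb)
        (fun hi => ⟨fun h => (hsflat z hi).1 (hp.segmentInteriors_subset h),
          fun h => (hsflat z hi).2 (hp.segmentInteriors_subset h)⟩)
        (fun _ => ⟨fun h => hcflat.1 (hp.segmentInteriors_subset h),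
          fun h => hcflat.2 (hp.segmentInteriors_subset h)⟩)
    rw [perturbOn_of_mem (by omega) (by omega), perturbOn_of_mem (by omega) (by omega),
      r1.eq_of_mem r3 hsk hkc, r2.eq_of_mem r3 hsk hkc]
    exact ⟨rfl, rfl⟩
  -- Past `S + 1` no constraint is left, so the projection decouples into single points and returns
  -- the datum `0`.
  · have hkS : S + 1 < k := by omega
    have hnot : ∀ i, S + 1 ≤ i → i ∉ segmentInteriors p S z z' := fun i hi h =>
      absurd (hp.segmentInteriors_subset h).2.1 (by omega)
    have r : IsWindowLS ∅ k k (y n - p) (h n) :=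
      (hh n).restrict (by omega) (by omega) (fun j _ _ => by omega)
        (fun _ => ⟨hnot _ (by omega), hnot _ (by omega)⟩)
        (fun _ => ⟨hnot _ (by omega), hnot _ (by omega)⟩)
    rw [r.eq_of_singleton, hd0 n k (by omega), perturbOn_of_lt (by omega),
      perturbOn_of_lt (by omega), add_zero]
    exact ⟨rfl, rfl⟩

end IsConvexWithSupport

/-! ### Regularity of the localized projection -/

theorem ConvexAt.add_smul_sub {A : Set ℕ} {z b : ℕ} {f g : ℕ → ℝ} (hf : ConvexAt A z b f)
    (hg : ConvexAt A z b g) {t : ℝ} (h0 : 0 ≤ t) (h1 : t ≤ 1) :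
    ConvexAt A z b fun j => f j + t * (g j - f j) := by
  intro j hj1 hj2 hA
  have e1 := mul_nonneg (sub_nonneg.2 h1) (hf j hj1 hj2 hA)
  have e2 := mul_nonneg h0 (hg j hj1 hj2 hA)
  simp only [laplacian] at *
  linarith

/-- The variational inequality of a convex projection: first-order optimality along the segment from
`g` to `q`. -/
theorem IsWindowLS.sum_mul_nonpos {A : Set ℕ} {z b : ℕ} {y g q : ℕ → ℝ}
    (h : IsWindowLS A z b y g) (hq : ConvexAt A z b q) :
    ∑ j ∈ Finset.Icc z b, (y j - g j) * (q j - g j) ≤ 0 := by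
  set B := ∑ j ∈ Finset.Icc z b, (y j - g j) * (q j - g j) with hB
  set C := ∑ j ∈ Finset.Icc z b, (q j - g j) ^ 2 with hC
  have hC0 : 0 ≤ C := Finset.sum_nonneg fun j _ => sq_nonneg _
  have key : ∀ t : ℝ, 0 ≤ t → t ≤ 1 → 2 * t * B ≤ t ^ 2 * C := by
    intro t h0 h1
    have e := h.2 _ (h.1.add_smul_sub hq h0 h1)
    have e1 : ∑ j ∈ Finset.Icc z b, (y j - (g j + t * (q j - g j))) ^ 2 =
        ∑ j ∈ Finset.Icc z b, (y j - g j) ^ 2 - 2 * t * B + t ^ 2 * C := by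
      rw [hB, hC, Finset.mul_sum, Finset.mul_sum, ← Finset.sum_sub_distrib,
        ← Finset.sum_add_distrib]
      exact Finset.sum_congr rfl fun j _ => by ring
    rw [e1] at e
    linarith
  by_contra! hBpos
  -- This step length lies in `(0, 1]` and satisfies `t * C < 2 * B`, with no separate case `C = 0`.
  have e := key (B / (B + C)) (by positivity) (by rw [div_le_one (by positivity)]; linarith)
  have hne : B + C ≠ 0 := by positivity
  have e1 : 2 * (B / (B + C)) * B - (B / (B + C)) ^ 2 * C =
      B ^ 2 * (2 * B + C) / (B + C) ^ 2 := by
    field_simp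
    ring
  have e2 : 0 < B ^ 2 * (2 * B + C) / (B + C) ^ 2 := by positivity
  linarith

/-- Add the two variational inequalities, each tested against the other minimizer. -/
theorem IsWindowLS.lipschitz {A : Set ℕ} {z b : ℕ} {y y' g g' : ℕ → ℝ}
    (h : IsWindowLS A z b y g) (h' : IsWindowLS A z b y' g') :
    ∑ j ∈ Finset.Icc z b, (g j - g' j) ^ 2 ≤ ∑ j ∈ Finset.Icc z b, (y j - y' j) ^ 2 := by
  have e := add_nonpos (h.sum_mul_nonpos h'.1) (h'.sum_mul_nonpos h.1)
  have e1 : ∑ j ∈ Finset.Icc z b, (g j - g' j) ^ 2 ≤ ∑ j ∈ Finset.Icc z b, (y j - y' j) ^ 2 +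
      2 * (∑ j ∈ Finset.Icc z b, (y j - g j) * (g' j - g j) +
        ∑ j ∈ Finset.Icc z b, (y' j - g' j) * (g j - g' j)) := by
    rw [← Finset.sum_add_distrib, Finset.mul_sum, ← Finset.sum_add_distrib]
    exact Finset.sum_le_sum fun j _ => by nlinarith [sq_nonneg (y j - y' j - (g j - g' j))]
  linarith

theorem IsWindowLS.const_mul {A : Set ℕ} {z b : ℕ} {y g : ℕ → ℝ} (h : IsWindowLS A z b y g)
    {r : ℝ} (hr : 0 < r) : IsWindowLS A z b (fun j => r * y j) fun j => r * g j := by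
  have hc : ∀ t : ℝ, 0 < t → ∀ q, ConvexAt A z b q → ConvexAt A z b fun j => t * q j := by
    intro t ht q hq j h1 h2 hA
    have e := mul_nonneg ht.le (hq j h1 h2 hA)
    simp only [laplacian] at *
    linarith
  refine ⟨hc r hr g h.1, fun q hq => ?_⟩
  have e := mul_le_mul_of_nonneg_left (h.2 _ (hc r⁻¹ (inv_pos.2 hr) q hq)) (sq_nonneg r)
  rw [Finset.mul_sum, Finset.mul_sum] at e
  calc ∑ j ∈ Finset.Icc z b, (r * y j - r * g j) ^ 2
      = ∑ j ∈ Finset.Icc z b, r ^ 2 * (y j - g j) ^ 2 :=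
        Finset.sum_congr rfl fun j _ => by ring
    _ ≤ _ := e
    _ = _ := Finset.sum_congr rfl fun j _ => by field_simp

theorem windowProj_const_mul (p : ℕ → ℝ) (S z z' : ℕ) (w : ℕ → ℝ) {r : ℝ} (hr : 0 < r)
    (k : Set.Icc z z') :
    windowProj p S z z' (fun j => r * w j) k = r * windowProj p S z z' w k := by
  obtain ⟨g, hg, e⟩ := isWindowLS_windowProj p S z z' w
  obtain ⟨f, hf, e'⟩ := isWindowLS_windowProj p S z z' fun j => r * w j
  rw [e, e']
  exact hf.eq_of_mem (hg.const_mul hr) k.2.1 k.2.2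

theorem continuous_windowProj (p : ℕ → ℝ) (S z z' : ℕ) (k : Set.Icc z z') :
    Continuous fun w : ℕ → ℝ => windowProj p S z z' w k := by
  choose g hg e using isWindowLS_windowProj p S z z'
  simp only [e]
  rw [continuous_iff_continuousAt]
  intro w
  rw [ContinuousAt, tendsto_iff_dist_tendsto_zero]
  have h1 : Tendsto (fun v : ℕ → ℝ => ∑ j ∈ Finset.Icc z z', (v j - w j) ^ 2) (𝓝 w) (𝓝 0) := by
    have : Continuous fun v : ℕ → ℝ => ∑ j ∈ Finset.Icc z z', (v j - w j) ^ 2 := by fun_prop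
    simpa using this.tendsto w
  have h2 : Tendsto (fun v : ℕ → ℝ => (g v k - g w k) ^ 2) (𝓝 w) (𝓝 0) :=
    squeeze_zero (fun v => sq_nonneg _) (fun v => (Finset.single_le_sum
      (f := fun j => (g v j - g w j) ^ 2) (fun j _ => sq_nonneg _)
      (Finset.mem_Icc.2 k.2)).trans ((hg v).lipschitz (hg w))) h1
  simpa [Real.sqrt_sq_eq_abs, Real.dist_eq] using h2.sqrt

/-! ### Convergence in distribution -/

/-- Reduces the characteristic function of a vector to those of its scalar projections, ready for
Lévy's continuity theorem. -/
theorem charFun_map_eq_charFun_inner {Ω E : Type*} [MeasurableSpace Ω] {P : Measure Ω}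
    [NormedAddCommGroup E] [InnerProductSpace ℝ E] [MeasurableSpace E] [BorelSpace E]
    [SecondCountableTopology E] {X : Ω → E} (hX : AEMeasurable X P) (t : E) :
    charFun (P.map X) t = charFun (P.map fun ω => inner ℝ (X ω) t) 1 := by
  rw [charFun_apply, charFun_apply, integral_map hX (by fun_prop), integral_map (by fun_prop)
    (by fun_prop)]
  simp

/-- The **Cramér–Wold device**. -/
theorem tendstoInDistribution_of_inner {Ω Ω' E : Type*} [MeasurableSpace Ω] [MeasurableSpace Ω']
    {P : Measure Ω} [IsProbabilityMeasure P] {P' : Measure Ω'} [IsProbabilityMeasure P']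
    [NormedAddCommGroup E] [InnerProductSpace ℝ E] [FiniteDimensional ℝ E] [MeasurableSpace E]
    [BorelSpace E] {X : ℕ → Ω → E} {Z : Ω' → E} (hX : ∀ n, AEMeasurable (X n) P)
    (hZ : AEMeasurable Z P')
    (h : ∀ t : E, TendstoInDistribution (fun n ω => inner ℝ (X n ω) t) atTop
      (fun ω => inner ℝ (Z ω) t) (fun _ => P) P') :
    TendstoInDistribution X atTop Z (fun _ => P) P' := by
  have := FiniteDimensional.proper_real E
  refine ⟨hX, hZ, ProbabilityMeasure.tendsto_iff_tendsto_charFun.2 fun t => ?_⟩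
  have e := ProbabilityMeasure.tendsto_iff_tendsto_charFun.1 (h t).tendsto 1
  simp only [ProbabilityMeasure.coe_mk] at e ⊢
  rw [charFun_map_eq_charFun_inner hZ]
  simp only [charFun_map_eq_charFun_inner (hX _)]
  exact e

/-! ### The Brownian bridge increments -/

theorem cdfBefore_mono {p : ℕ → ℝ} (hp : ∀ j, 0 ≤ p j) : Monotone (cdfBefore p) :=
  monotone_nat_of_le_succ fun n => by
    rw [cdfBefore, cdfBefore, Finset.sum_range_succ]
    linarith [hp n]

section Bridge

variable {Ω : Type*} [MeasurableSpace Ω] {P : Measure Ω} {U : ℝ → Ω → ℝ} {p : ℕ → ℝ}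

theorem IsBrownianBridge.hasGaussianLaw_bridgeIncrement (hU : IsBrownianBridge U P)
    (hp1 : ∀ k, cdfBefore p k ∈ Set.Icc (0 : ℝ) 1) (N : ℕ) :
    HasGaussianLaw (fun ω (j : Fin N) => bridgeIncrement U p ω j) P :=
  hU.gaussian.hasGaussianLaw_increments (t := fun j : Fin (N + 1) => ⟨cdfBefore p j, hp1 j⟩)

theorem IsBrownianBridge.memLp (hU : IsBrownianBridge U P) {t : ℝ} (ht : t ∈ Set.Icc (0 : ℝ) 1) :
    MemLp (U t) 2 P :=
  (hU.gaussian.hasGaussianLaw_eval ⟨t, ht⟩).memLp_two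

theorem IsBrownianBridge.integral_bridgeIncrement (hU : IsBrownianBridge U P)
    [IsProbabilityMeasure P] (hp1 : ∀ k, cdfBefore p k ∈ Set.Icc (0 : ℝ) 1) (j : ℕ) :
    ∫ ω, bridgeIncrement U p ω j ∂P = 0 := by
  simp only [bridgeIncrement]
  rw [integral_sub ((hU.memLp (hp1 _)).integrable (by norm_num))
    ((hU.memLp (hp1 _)).integrable (by norm_num)), hU.mean_zero _ (hp1 _),
    hU.mean_zero _ (hp1 _), sub_zero]

/-- This is the covariance of the indicators of the values `i` and `j` for one observation; compare
`covariance_valueIndicator`. -/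
theorem IsBrownianBridge.covariance_bridgeIncrement (hU : IsBrownianBridge U P)
    [IsProbabilityMeasure P] (hp : ∀ j, 0 ≤ p j)
    (hp1 : ∀ k, cdfBefore p k ∈ Set.Icc (0 : ℝ) 1) (i j : ℕ) :
    cov[fun ω => bridgeIncrement U p ω i, fun ω => bridgeIncrement U p ω j; P] =
      (if i = j then p i else 0) - p i * p j := by
  have hm := fun k => hU.memLp (hp1 k)
  have hc : ∀ a b, a ≤ b → cov[U (cdfBefore p a), U (cdfBefore p b); P] =
      cdfBefore p a * (1 - cdfBefore p b) := fun a b hab =>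
    hU.covariance _ (hp1 a) _ (hp1 b) (cdfBefore_mono hp hab)
  have hs : ∀ k, cdfBefore p (k + 1) = cdfBefore p k + p k := fun k => by
    rw [cdfBefore, cdfBefore, Finset.sum_range_succ]
  have hexp : cov[fun ω => bridgeIncrement U p ω i, fun ω => bridgeIncrement U p ω j; P] =
      cov[U (cdfBefore p (i + 1)), U (cdfBefore p (j + 1)); P] -
        cov[U (cdfBefore p (i + 1)), U (cdfBefore p j); P] -
        (cov[U (cdfBefore p i), U (cdfBefore p (j + 1)); P] -
          cov[U (cdfBefore p i), U (cdfBefore p j); P]) := by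
    rw [← covariance_sub_right (hm _) (hm _) (hm _), ← covariance_sub_right (hm _) (hm _) (hm _),
      ← covariance_sub_left (hm _) (hm _) ((hm _).sub (hm _))]
    rfl
  rw [hexp]
  rcases lt_trichotomy i j with h | rfl | h
  · rw [hc _ _ (by omega), hc _ _ (by omega), hc _ _ (by omega), hc _ _ (by omega), if_neg h.ne,
      hs, hs]
    ring
  · rw [covariance_comm (U (cdfBefore p (i + 1))) (U (cdfBefore p i)), hc _ _ (by omega),
      hc _ _ (by omega), hc _ _ (by omega), if_pos rfl, hs]
    ring
  · rw [covariance_comm (U (cdfBefore p (i + 1))) (U (cdfBefore p (j + 1))),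
      covariance_comm (U (cdfBefore p (i + 1))) (U (cdfBefore p j)),
      covariance_comm (U (cdfBefore p i)) (U (cdfBefore p (j + 1))),
      covariance_comm (U (cdfBefore p i)) (U (cdfBefore p j)),
      hc _ _ (by omega), hc _ _ (by omega), hc _ _ (by omega), hc _ _ (by omega), if_neg h.ne',
      hs, hs]
    ring

end Bridge

/-! ### The empirical probability mass function -/

/-- The indicator of the value `j`. -/
noncomputable def valueIndicator (j x : ℕ) : ℝ := if x = j then 1 else 0

theorem integral_valueIndicator {Ω : Type*} [MeasurableSpace Ω] {P : Measure Ω}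
    {Y : Ω → ℕ} (hY : Measurable Y) (j : ℕ) :
    ∫ ω, valueIndicator j (Y ω) ∂P = P.real {ω | Y ω = j} := by
  have : (fun ω => valueIndicator j (Y ω)) = {ω | Y ω = j}.indicator 1 := by
    ext ω
    simp [valueIndicator, Set.indicator_apply]
  rw [this]
  exact integral_indicator_one (hY (measurableSet_singleton j))

theorem inner_sqrt_mul_empiricalPmf_sub {Ω : Type*} (X : ℕ → Ω → ℕ) (p : ℕ → ℝ) {N : ℕ}
    (t : EuclideanSpace ℝ (Fin N))
    (n : ℕ) (ω : Ω) :
    inner ℝ (WithLp.toLp 2 fun j : Fin N => Real.sqrt n * (empiricalPmf X n ω j - p j)) t =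
      (Real.sqrt n)⁻¹ * (∑ i ∈ Finset.range n, ∑ j : Fin N, t j * valueIndicator j (X i ω) -
        n * ∑ j : Fin N, t j * p j) := by
  rw [Finset.sum_comm, Finset.mul_sum, ← Finset.sum_sub_distrib, Finset.mul_sum,
    PiLp.inner_apply]
  refine Finset.sum_congr rfl fun j _ => ?_
  rw [← Finset.mul_sum]
  have e : empiricalPmf X n ω j =
      (1 / (n : ℝ)) * ∑ i ∈ Finset.range n, valueIndicator j (X i ω) := rfl
  simp only [e, RCLike.inner_apply, conj_trivial]
  -- For `n = 0` both sides vanish, as `√0` and its inverse are `0`.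
  rcases Nat.eq_zero_or_pos n with rfl | hn
  · simp
  · have hn' : (0 : ℝ) < n := Nat.cast_pos.2 hn
    have h2 : Real.sqrt n ^ 2 = n := Real.sq_sqrt hn'.le
    have h3 : Real.sqrt n ≠ 0 := (Real.sqrt_pos.2 hn').ne'
    field_simp
    rw [h2]

section Sample

variable {Ω : Type*} [MeasurableSpace Ω] {P : Measure Ω} [IsProbabilityMeasure P]

theorem memLp_valueIndicator {Y : Ω → ℕ} (hY : Measurable Y) (j : ℕ) :
    MemLp (fun ω => valueIndicator j (Y ω)) 2 P :=
  MemLp.of_bound (((Measurable.of_discrete (f := valueIndicator j)).comp hY).aestronglyMeasurable)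
    1 (Eventually.of_forall fun ω => by
      simp only [valueIndicator]
      split_ifs <;> simp)

theorem covariance_valueIndicator {Y : Ω → ℕ} (hY : Measurable Y) (i j : ℕ) :
    cov[fun ω => valueIndicator i (Y ω), fun ω => valueIndicator j (Y ω); P] =
      (if i = j then P.real {ω | Y ω = i} else 0) -
        P.real {ω | Y ω = i} * P.real {ω | Y ω = j} := by
  rw [covariance_eq_sub (memLp_valueIndicator hY i) (memLp_valueIndicator hY j),
    integral_valueIndicator hY, integral_valueIndicator hY]
  congr 1
  by_cases h : i = j
  · subst h
    rw [if_pos rfl, ← integral_valueIndicator hY]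
    refine integral_congr_ae (Eventually.of_forall fun ω => ?_)
    simp only [valueIndicator, Pi.mul_apply]
    split_ifs <;> simp
  · rw [if_neg h]
    refine integral_eq_zero_of_ae (Eventually.of_forall fun ω => ?_)
    simp only [valueIndicator, Pi.mul_apply, Pi.zero_apply]
    split_ifs <;> first | omega | simp

theorem cdfBefore_mem_Icc {p : ℕ → ℝ} {Y : Ω → ℕ} (hY : Measurable Y)
    (hlaw : ∀ j, P.real {ω | Y ω = j} = p j) (k : ℕ) : cdfBefore p k ∈ Set.Icc (0 : ℝ) 1 := by
  have : cdfBefore p k = P.real (Y ⁻¹' (Finset.range k : Finset ℕ)) := by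
    rw [cdfBefore, ← sum_measureReal_preimage_singleton _
      fun j _ => hY (measurableSet_singleton j)]
    exact Finset.sum_congr rfl fun j _ => (hlaw j).symm
  rw [this]
  exact ⟨measureReal_nonneg, measureReal_le_one⟩

variable {X : ℕ → Ω → ℕ} {p : ℕ → ℝ}

theorem identDistrib_of_law (hXmeas : ∀ i, Measurable (X i))
    (hXlaw : ∀ i j, P.real {ω | X i ω = j} = p j) (i : ℕ) : IdentDistrib (X i) (X 0) P P := by
  refine ⟨(hXmeas i).aemeasurable, (hXmeas 0).aemeasurable, Measure.ext_of_singleton fun j => ?_⟩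
  rw [Measure.map_apply (hXmeas i) (measurableSet_singleton j),
    Measure.map_apply (hXmeas 0) (measurableSet_singleton j)]
  have := (hXlaw i j).trans (hXlaw 0 j).symm
  exact (measureReal_eq_measureReal_iff).1 this

theorem ae_tendsto_empiricalPmf (hXmeas : ∀ i, Measurable (X i)) (hXindep : iIndepFun X P)
    (hXlaw : ∀ i j, P.real {ω | X i ω = j} = p j) :
    ∀ᵐ ω ∂P, ∀ j, Tendsto (fun n => empiricalPmf X n ω j) atTop (𝓝 (p j)) := by
  refine ae_all_iff.2 fun j => ?_
  have := strong_law_ae_real (fun i ω => valueIndicator j (X i ω))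
    ((memLp_valueIndicator (hXmeas 0) j).integrable (by norm_num))
    (fun a b hab => (hXindep.indepFun hab).comp (φ := valueIndicator j) (ψ := valueIndicator j)
      Measurable.of_discrete Measurable.of_discrete)
    (fun i => (identDistrib_of_law hXmeas hXlaw i).comp (u := valueIndicator j)
      Measurable.of_discrete)
  rw [integral_valueIndicator (hXmeas 0), hXlaw] at this
  filter_upwards [this] with ω h
  refine h.congr fun n => ?_
  rw [empiricalPmf, div_eq_inv_mul, one_div]
  rfl

theorem ae_empiricalPmf_eq_zero {S : ℕ} (hXlaw : ∀ i j, P.real {ω | X i ω = j} = p j)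
    (hp : ∀ j, S < j → p j = 0) :
    ∀ᵐ ω ∂P, ∀ n j, S < j → empiricalPmf X n ω j = 0 := by
  have : ∀ᵐ ω ∂P, ∀ i j, S < j → X i ω ≠ j := by
    refine ae_all_iff.2 fun i => ae_all_iff.2 fun j => ?_
    by_cases hj : S < j
    · have h0 : P {ω | X i ω = j} = 0 := by
        rw [← measureReal_eq_zero_iff, hXlaw, hp j hj]
      filter_upwards [measure_eq_zero_iff_ae_notMem.1 h0] with ω h _ using h
    · exact Eventually.of_forall fun ω h => absurd h hj
  filter_upwards [this] with ω h n j hj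
  simp [empiricalPmf, h _ j hj]

/-- Every statistic of the empirical probability mass function is measurable. -/
theorem measurable_comp_empiricalPmf {β : Type*} [MeasurableSpace β]
    (hXmeas : ∀ i, Measurable (X i)) (F : (ℕ → ℝ) → β) (n : ℕ) :
    Measurable fun ω => F (empiricalPmf X n ω) := by
  -- The statistic factors through `Fin n → ℕ`, a countable discrete space on which every function
  -- is measurable; no regularity of `F` is needed.
  have h : (fun ω => F (empiricalPmf X n ω)) =
      (fun v : Fin n → ℕ => F fun j => (1 / (n : ℝ)) * ∑ i, if v i = j then 1 else 0) ∘
        fun ω i => X i ω := by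
    ext ω
    simp only [Function.comp_apply]
    congr 1
    ext j
    rw [empiricalPmf, Finset.sum_range]
  rw [h]
  exact Measurable.of_discrete.comp (measurable_pi_lambda _ fun i => hXmeas i)

/-- **Central limit theorem for the empirical probability mass function.** -/
theorem tendstoInDistribution_empiricalPmf (hXmeas : ∀ i, Measurable (X i))
    (hXindep : iIndepFun X P) (hXlaw : ∀ i j, P.real {ω | X i ω = j} = p j)
    {Ω' : Type*} [MeasurableSpace Ω'] {P' : Measure Ω'} [IsProbabilityMeasure P']
    {U : ℝ → Ω' → ℝ} (hU : IsBrownianBridge U P') (N : ℕ) :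
    TendstoInDistribution
      (fun (n : ℕ) ω => (WithLp.toLp 2 fun j : Fin N =>
        Real.sqrt n * (empiricalPmf X n ω j - p j) : EuclideanSpace ℝ (Fin N)))
      atTop (fun ω => WithLp.toLp 2 fun j : Fin N => bridgeIncrement U p ω j)
      (fun _ => P) P' := by
  have hp : ∀ j, 0 ≤ p j := fun j => hXlaw 0 j ▸ measureReal_nonneg
  have hp1 := cdfBefore_mem_Icc (hXmeas 0) (hXlaw 0)
  have hG := hU.hasGaussianLaw_bridgeIncrement hp1 N
  refine tendstoInDistribution_of_inner (fun n => ?_) ?_ fun t => ?_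
  · exact (measurable_comp_empiricalPmf hXmeas (fun y => (WithLp.toLp 2 fun j : Fin N =>
      Real.sqrt n * (y j - p j) : EuclideanSpace ℝ (Fin N))) n).aemeasurable
  · exact (WithLp.measurable_toLp 2 (Fin N → ℝ)).comp_aemeasurable hG.aemeasurable
  · have hW : ∀ ω, inner ℝ (WithLp.toLp 2 fun j : Fin N => bridgeIncrement U p ω j) t =
        ∑ j : Fin N, t j * bridgeIncrement U p ω j := fun ω => by
      rw [PiLp.inner_apply]
      simp
    simp only [inner_sqrt_mul_empiricalPmf_sub, hW]
    let f : ℕ → ℝ := fun x => ∑ j : Fin N, t j * valueIndicator j x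
    have hmem : ∀ i, ∀ j : Fin N, MemLp (fun ω => t j * valueIndicator j (X i ω)) 2 P :=
      fun i j => (memLp_valueIndicator (hXmeas i) j).const_mul (t j)
    have hWmem : ∀ j : Fin N, MemLp (fun ω => bridgeIncrement U p ω j) 2 P' := fun j =>
      (hU.memLp (hp1 _)).sub (hU.memLp (hp1 _))
    have hint : ∫ ω, f (X 0 ω) ∂P = ∑ j : Fin N, t j * p j := by
      rw [integral_finsetSum _ fun j _ => (hmem 0 j).integrable (by norm_num)]
      refine Finset.sum_congr rfl fun j _ => ?_
      rw [integral_const_mul, integral_valueIndicator (hXmeas 0), hXlaw]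
    -- The limit is a centred Gaussian, so matching its variance with that of one summand identifies
    -- it.
    have hvar : Var[fun ω => ∑ j : Fin N, t j * bridgeIncrement U p ω j; P'] =
        Var[fun ω => f (X 0 ω); P] := by
      rw [variance_fun_sum fun j => (hWmem j).const_mul (t j), variance_fun_sum (hmem 0)]
      refine Finset.sum_congr rfl fun i _ => Finset.sum_congr rfl fun j _ => ?_
      rw [covariance_const_mul_left, covariance_const_mul_right, covariance_const_mul_left,
        covariance_const_mul_right, hU.covariance_bridgeIncrement hp hp1,
        covariance_valueIndicator (hXmeas 0), hXlaw, hXlaw]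
    have hgauss : HasGaussianLaw (fun ω => ∑ j : Fin N, t j * bridgeIncrement U p ω j) P' := by
      have := hG.map_fun (∑ j : Fin N, t j • ContinuousLinearMap.proj (R := ℝ) j)
      simpa using this
    have hmean : ∫ ω, ∑ j : Fin N, t j * bridgeIncrement U p ω j ∂P' = 0 := by
      rw [integral_finsetSum _ fun j _ => ((hWmem j).const_mul (t j)).integrable (by norm_num)]
      refine Finset.sum_eq_zero fun j _ => ?_
      rw [integral_const_mul, hU.integral_bridgeIncrement hp1, mul_zero]
    have hlaw : HasLaw (fun ω => ∑ j : Fin N, t j * bridgeIncrement U p ω j)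
        (gaussianReal 0 Var[fun ω => f (X 0 ω); P].toNNReal) P' := by
      refine ⟨hgauss.aemeasurable, ?_⟩
      rw [hgauss.map_eq_gaussianReal, hmean, hvar]
    have := tendstoInDistribution_inv_sqrt_mul_sum_sub (X := fun i ω => f (X i ω)) hlaw
      (memLp_finsetSum _ fun j _ => hmem 0 j)
      (hXindep.comp (fun _ => f) fun _ => Measurable.of_discrete)
      (fun i => (identDistrib_of_law hXmeas hXlaw i).comp (u := f) Measurable.of_discrete)
    rw [hint] at this
    exact this

end Sample

end ConvexPmf

/-! ### The main theorem -/

open ConvexPmf in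
theorem theorem7 {Ω : Type*} [MeasurableSpace Ω] (P : Measure Ω) [IsProbabilityMeasure P]
    (p₀ : ℕ → ℝ) (hp₀ : p₀ ∈ convexSeqs)
    (S : ℕ) (hS : 0 < S) (hsupp : Function.support p₀ = Set.Iic S)
    (X : ℕ → Ω → ℕ) (hXmeas : ∀ i, Measurable (X i)) (hXindep : iIndepFun X P)
    (hXlaw : ∀ i j, P.real {ω | X i ω = j} = p₀ j)
    {I : ℕ} (k : Fin I → ℕ) (hk : StrictMono k)
    (s s' : ℕ) (hsk : ∀ i, s ≤ k i) (hks' : ∀ i, k i ≤ s')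
    (hs : s = 0 ∨ ∃ t, s = t + 1 ∧ IsDoubleKnot p₀ t)
    (hs' : IsDoubleKnot p₀ s' ∨ S + 1 ≤ s')
    (z z' : ℕ) (hz : z ≤ s) (hz' : s' ≤ z') :
    (∀ᵐ ω ∂P, ∃ n₀ : ℕ, ∀ n ≥ n₀, ∀ i,
      convexLSE (empiricalPmf X n ω) (k i) =
        windowLSE z z' (empiricalPmf X n ω)
          ⟨k i, hz.trans (hsk i), (hks' i).trans hz'⟩) ∧
    ∀ {Ω' : Type*} [MeasurableSpace Ω'] (P' : Measure Ω') [IsProbabilityMeasure P']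
      (U : ℝ → Ω' → ℝ), IsBrownianBridge U P' →
      TendstoInDistribution
        (fun (n : ℕ) ω (i : Fin I) =>
          Real.sqrt n * (convexLSE (empiricalPmf X n ω) (k i) - p₀ (k i)))
        atTop
        (fun ω' (i : Fin I) =>
          windowProj p₀ S z z' (bridgeIncrement U p₀ ω')
            ⟨k i, hz.trans (hsk i), (hks' i).trans hz'⟩)
        (fun _ => P) P' := by
  have hp : IsConvexWithSupport p₀ S :=
    ⟨hp₀.1, fun j => hXlaw 0 j ▸ measureReal_nonneg, hsupp⟩
  have hae : ∀ᵐ ω ∂P, ∀ᶠ n in atTop, ∀ k (h1 : s ≤ k) (h2 : k ≤ s'),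
      convexLSE (empiricalPmf X n ω) k = p₀ k +
        windowProj p₀ S z z' (empiricalPmf X n ω - p₀) ⟨k, hz.trans h1, h2.trans hz'⟩ ∧
      windowLSE z z' (empiricalPmf X n ω) ⟨k, hz.trans h1, h2.trans hz'⟩ = p₀ k +
        windowProj p₀ S z z' (empiricalPmf X n ω - p₀) ⟨k, hz.trans h1, h2.trans hz'⟩ := by
    filter_upwards [ae_tendsto_empiricalPmf hXmeas hXindep hXlaw,
      ae_empiricalPmf_eq_zero hXlaw fun j => hp.eq_zero] with ω h1 h2
    exact hp.eventually_lse_eq h1 h2 hs hs' hz hz'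
  refine ⟨?_, ?_⟩
  · filter_upwards [hae] with ω h
    obtain ⟨n₀, hn₀⟩ := eventually_atTop.1 h
    refine ⟨n₀, fun n hn i => ?_⟩
    obtain ⟨h1, h2⟩ := hn₀ n hn (k i) (hsk i) (hks' i)
    exact h1.trans h2.symm
  · intro Ω' _ P' _ U hU
    -- The projection only sees coordinates up to `z'`, so the limit theorem in dimension `z' + 1`
    -- suffices; the zero padding is irrelevant.
    let ext : EuclideanSpace ℝ (Fin (z' + 1)) → ℕ → ℝ :=
      fun v j => if h : j < z' + 1 then v ⟨j, h⟩ else 0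
    let Φ : EuclideanSpace ℝ (Fin (z' + 1)) → Fin I → ℝ := fun v i =>
      windowProj p₀ S z z' (ext v) ⟨k i, hz.trans (hsk i), (hks' i).trans hz'⟩
    have hΦ : Continuous Φ := by
      refine continuous_pi fun i => (continuous_windowProj p₀ S z z' _).comp ?_
      refine continuous_pi fun j => ?_
      by_cases h : j < z' + 1
      · simp only [ext, dif_pos h]
        fun_prop
      · simp only [ext, dif_neg h]
        fun_prop
    have hext : ∀ w : ℕ → ℝ, ∀ i, Φ (WithLp.toLp 2 fun j => w j) i =
        windowProj p₀ S z z' w ⟨k i, hz.trans (hsk i), (hks' i).trans hz'⟩ := by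
      intro w i
      have : (fun j : Set.Icc z z' => ext (WithLp.toLp 2 fun j => w j) j) =
          fun j : Set.Icc z z' => w j := by
        ext ⟨j, hj⟩
        exact dif_pos (Nat.lt_succ_of_le hj.2)
      simp only [Φ, windowProj, this]
    have hclt := (tendstoInDistribution_empiricalPmf hXmeas hXindep hXlaw hU
      (z' + 1)).continuous_comp hΦ
    have hlim : (Φ ∘ fun ω => WithLp.toLp 2 fun j : Fin (z' + 1) => bridgeIncrement U p₀ ω j) =
        fun ω' (i : Fin I) => windowProj p₀ S z z' (bridgeIncrement U p₀ ω')
          ⟨k i, hz.trans (hsk i), (hks' i).trans hz'⟩ := by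
      ext ω i
      exact hext (bridgeIncrement U p₀ ω) i
    rw [hlim] at hclt
    have hmeas : ∀ n : ℕ, Measurable fun ω (i : Fin I) =>
        Real.sqrt n * (convexLSE (empiricalPmf X n ω) (k i) - p₀ (k i)) := fun n =>
      measurable_comp_empiricalPmf hXmeas
        (fun y (i : Fin I) => Real.sqrt n * (convexLSE y (k i) - p₀ (k i))) n
    -- Slutsky: the rescaled error and `Φ` of the rescaled empirical error differ by a sequence that
    -- is almost surely eventually zero.
    refine tendstoInDistribution_of_tendstoInMeasure_sub _ _ hclt ?_
      fun n => (hmeas n).aemeasurable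
    refine tendstoInMeasure_of_tendsto_ae (fun n =>
      ((hmeas n).aemeasurable.sub (hclt.forall_aemeasurable n)).aestronglyMeasurable) ?_
    filter_upwards [hae] with ω h
    refine tendsto_const_nhds.congr' ?_
    filter_upwards [h, eventually_gt_atTop 0] with n hn hn0
    ext i
    -- Positive homogeneity moves the factor `√n` out of the projection; this needs `n > 0`.
    have e := hext (fun j => Real.sqrt n * (empiricalPmf X n ω - p₀) j) i
    rw [windowProj_const_mul _ _ _ _ _ (Real.sqrt_pos.2 (Nat.cast_pos.2 hn0))] at e
    simp only [Pi.sub_apply] at e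
    simp only [Pi.sub_apply, Pi.zero_apply, Function.comp_apply]
    rw [e, (hn (k i) (hsk i) (hks' i)).1]
    ring
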